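/- Write $f_C(x;\lambda)=\frac{1}{\lambda\pi}\frac{1}{1+(x/\lambda)^2}$ and $F_C(x;\lambda)=\frac12+\frac1\pi\arctan(x/\lambda)$ for the density and CDF of the zero-mean Cauchy distribution with scale $\lambda>0$, and $f_G(x;\sigma)$, $F_G(x;\sigma)$ for the density and CDF of the zero-mean Gaussian distribution with standard deviation $\sigma>0$. A probability distribution on $\mathbb R$ is called *symmetric unimodal* (s.u.) if it has a density that is even and nonincreasing on $(0,\infty)$. A CDF $F_{ob}$ *overbounds* a CDF $F$ if $F_{ob}(x)\ge F(x)$ whenever $F(x)\le\frac12$ and $F_{ob}(x)\le F(x)$ whenever $F(x)>\frac12$. Let $\varepsilon_1,\dots,\varepsilon_N$ be independent real random variables whose distributions are s.u., with CDFs $F_{e,1},\dots,F_{e,N}$, and let $S_1,\dots,S_N\in\mathbb R$. For each $i$ suppose that $\sigma_i$ is the least $\sigma>0$ with $$F_G(x;\sigma)\ge F_{e,i}(x)\ \ (x\le 0),\qquad F_G(x;\sigma)\le F_{e,i}(x)\ \ (x>0),$$ and that $\lambda_i$ is the least $\lambda>0$ with $$F_C(x;\lambda)\ge F_{e,i}(x)\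 \ (x\le 0),\qquad F_C(x;\lambda)\le F_{e,i}(x)\ \ (x>0),\qquad \lambda\le\sqrt{2/\pi}\,\sigma_i .$$ Call $(x_1,x_2)$ a *tangent pair* for $i$ if $0<x_1<x_2$ and $$f_C(x_1;\lambda_i)=f_G(x_2;\sigma_i)=\frac{F_G(x_2;\sigma_i)-F_C(x_1;\lambda_i)}{x_2-x_1}.$$ (1) For each $i$, a tangent pair exists if and only if $F_C(\cdot;\lambda_i)$ does not overbound $F_G(\cdot;\sigma_i)$. (2) For each $i$ let $(x_{1,i},x_{2,i})$ be a tangent pair, put $K_i=f_C(x_{1,i};\lambda_i)$, and define $$T_{R,i}(x)=K_i(x-x_{1,i})+F_C(x_{1,i};\lambda_i)\ \ (x_{1,i}\le x\le x_{2,i}),\qquad T_{L,i}(x)=K_i(x+x_{1,i})+F_C(-x_{1,i};\lambda_i)\ \ (-x_{2,i}\le x\le -x_{1,i}),$$ $$F_{ob,i}(x)=\begin{cases}\min\big(F_C(x;\lambda_i),\,T_{L,i}(x),\,F_G(x;\sigma_i)\big), & x\le 0,\\ \max\big(F_C(x;\lambda_i),\,T_{R,i}(x),\,F_G(x;\sigma_i)\big),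 & x>0,\end{cases}$$ where $T_{L,i}$ and $T_{R,i}$ enter only on the intervals on which they are defined. Then for each $i$: (a) $F_{ob,i}(x)=F_C(x;\lambda_i)$ for $|x|\le x_{1,i}$, $F_{ob,i}=T_{R,i}$ on $[x_{1,i},x_{2,i}]$, $F_{ob,i}=T_{L,i}$ on $[-x_{2,i},-x_{1,i}]$, and $F_{ob,i}(x)=F_G(x;\sigma_i)$ for $|x|\ge x_{2,i}$; (b) $F_{ob,i}$ is the CDF of a symmetric unimodal probability distribution; (c) $F_{ob,i}$ overbounds $F_{e,i}$. Moreover, (d): let $\nu_i$ be the probability distribution with CDF $F_{ob,i}$, and let $\nu$ be the convolution over $i=1,\dots,N$ of the images of $\nu_i$ under $x\mapsto |S_i|x$ (when all $S_i\neq0$, $\nu$ has as density the convolution of the functions $x\mapsto |S_i|^{-1}f_{ob,i}(x/|S_i|)$, where $f_{ob,i}$ is a density of $\nu_i$). Then the CDF of $\nu$ overbounds the CDF of the position-domain error $\sum_{i=1}^N S_i\varepsilon_i$. -/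

import Mathlib

namespace CauchyGaussian

open MeasureTheory ProbabilityTheory

/-- PDF of the zero-mean Cauchy distribution `C(0, lam)`. -/
noncomputable def fC (lam x : ℝ) : ℝ :=
  1 / (lam * Real.pi) * (1 / (1 + (x / lam) ^ 2))

/-- CDF of the zero-mean Cauchy distribution `C(0, lam)`. -/
noncomputable def FC (lam x : ℝ) : ℝ :=
  1 / 2 + 1 / Real.pi * Real.arctan (x / lam)

/-- PDF of the zero-mean Gaussian distribution with standard deviation `sig`. -/
noncomputable def fG (sig x : ℝ) : ℝ :=
  gaussianPDFReal 0 ⟨sig ^ 2, sq_nonneg sig⟩ x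

/-- CDF of the zero-mean Gaussian distribution with standard deviation `sig`. -/
noncomputable def FG (sig x : ℝ) : ℝ :=
  cdf (gaussianReal 0 ⟨sig ^ 2, sq_nonneg sig⟩) x

/-- `μ` is symmetric unimodal (s.u.) about `0`: it has a density which is even and
nonincreasing on `(0, ∞)`. The density may be unbounded near `0`. -/
def IsSymmUnimodal (μ : Measure ℝ) : Prop :=
  ∃ f : ℝ → ℝ, Measurable f ∧ (∀ x, 0 ≤ f x) ∧ (∀ x, f (-x) = f x) ∧
    AntitoneOn f (Set.Ioi 0) ∧ μ = volume.withDensity (fun x => ENNReal.ofReal (f x))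

/-- `F` is the CDF of a symmetric unimodal probability distribution. -/
def IsSymmUnimodalCDF (F : ℝ → ℝ) : Prop :=
  ∃ ν : Measure ℝ, IsProbabilityMeasure ν ∧ IsSymmUnimodal ν ∧ ∀ x, cdf ν x = F x

/-- The CDF `Fob` overbounds the CDF `Fe`. -/
def Overbounds (Fob Fe : ℝ → ℝ) : Prop :=
  (∀ x, Fe x ≤ 1 / 2 → Fe x ≤ Fob x) ∧ (∀ x, 1 / 2 < Fe x → Fob x ≤ Fe x)

/-- `sig` is the minimum scale of a zero-mean Gaussian overbound of the error CDF `Fe`. -/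
def IsOptimalGaussianScale (Fe : ℝ → ℝ) (sig : ℝ) : Prop :=
  IsLeast {s : ℝ | 0 < s ∧ (∀ x ≤ 0, Fe x ≤ FG s x) ∧ (∀ x > 0, FG s x ≤ Fe x)} sig

/-- `lam` is the minimum scale of a zero-mean Cauchy overbound of the error CDF `Fe`, among
scales at most `√(2/π) * sig`, where `sig` is the optimal Gaussian scale. -/
def IsOptimalCauchyScale (Fe : ℝ → ℝ) (sig lam : ℝ) : Prop :=
  IsLeast {l : ℝ | 0 < l ∧ (∀ x ≤ 0, Fe x ≤ FC l x) ∧ (∀ x > 0, FC l x ≤ Fe x) ∧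
    l ≤ Real.sqrt (2 / Real.pi) * sig} lam

/-- `x₁ < x₂` are the abscissae of the points at which a common tangent line touches the Cauchy
CDF (at `x₁`) and the Gaussian CDF (at `x₂`) on the right half-line. -/
def IsTangentPair (lam sig x₁ x₂ : ℝ) : Prop :=
  0 < x₁ ∧ x₁ < x₂ ∧ fC lam x₁ = fG sig x₂ ∧
    fG sig x₂ = (FG sig x₂ - FC lam x₁) / (x₂ - x₁)

/-- The line carrying the right tangential segment, used on `[x₁, x₂]` only. -/
noncomputable def TR (lam x₁ x : ℝ) : ℝ :=
  fC lam x₁ * (x - x₁) + FC lam x₁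

/-- The line carrying the left tangential segment, used on `[-x₂, -x₁]` only. -/
noncomputable def TL (lam x₁ x : ℝ) : ℝ :=
  fC lam x₁ * (x + x₁) + FC lam (-x₁)

/-- The Cauchy-Gaussian overbound: on `x ≤ 0` the minimum, on `x > 0` the maximum, of the Cauchy
CDF, the Gaussian CDF and, on its interval of definition, the tangential segment. -/
noncomputable def Fob (lam sig x₁ x₂ x : ℝ) : ℝ :=
  if x ≤ 0 then
    if -x₂ ≤ x ∧ x ≤ -x₁ then min (FC lam x) (min (TL lam x₁ x) (FG sig x))
    else min (FC lam x) (FG sig x)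
  else
    if x₁ ≤ x ∧ x ≤ x₂ then max (FC lam x) (max (TR lam x₁ x) (FG sig x))
    else max (FC lam x) (FG sig x)

/-- Convolution of finitely many measures on the line. -/
noncomputable def convN : (N : ℕ) → (Fin N → Measure ℝ) → Measure ℝ
  | 0, _ => Measure.dirac 0
  | n + 1, ν => (ν 0).conv (convN n (fun i => ν i.succ))

/-- Projection of range-domain distributions to the position domain with coefficients `S`: the
convolution of the distributions rescaled by `|S i|`. If all `S i ≠ 0` and `ν i` has density
`f i`, its density is the convolution of the functions `x ↦ |S i|⁻¹ * f i (x / |S i|)`. -/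
noncomputable def projected {N : ℕ} (S : Fin N → ℝ) (ν : Fin N → Measure ℝ) : Measure ℝ :=
  convN N (fun i => (ν i).map (fun x => |S i| * x))

end CauchyGaussian

/-!
The Cauchy core, the segment and the Gaussian tail of the overbound meet with equal slopes, and
these slopes decrease, so the overbound has a symmetric unimodal density. The CDF of a symmetric
unimodal error is concave on the right half-line. Hence the tangential segment, whose ends lie on
the Cauchy and Gaussian CDFs and so below the error CDF, stays below it.

As a function of `x ^ 2`, the difference `1 / fG - 1 / fC` is strictly convex. Since `FC - FG`
vanishes at `0` and at infinity, it follows that on the right half-line the two CDFs cross at most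
once, from `FG < FC` to `FC < FG`. When they do cross, the tangent to `FC` parallel to a tangent to
`FG` moves from above the latter to below it, and coincides with it at some point.

For symmetric unimodal laws, overbounding is Birnbaum's peakedness order: every centered interval
gets at least as much mass. The mass that such a law gives to an interval of fixed length decreases
as the interval moves away from `0`, so conditioning on one summand writes the mass of a centered
interval under a convolution as the integral of a function decreasing in `|x|`. Hence convolution
preserves both unimodality (Wintner) and peakedness (Birnbaum).
-/

namespace CauchyGaussian

open MeasureTheory ProbabilityTheory Set Filter Metric
open scoped ENNReal Topology

section Peakedness

variable {E : Type*} [SeminormedAddCommGroup E]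

/-- A set closed under passing to vectors of smaller norm. These are the sets on which measures
are compared by `PeakedLE.measure_le`. -/
def IsCentered (A : Set E) : Prop := ∀ ⦃x⦄, x ∈ A → ∀ ⦃y⦄, ‖y‖ ≤ ‖x‖ → y ∈ A

theorem isCentered_ball_zero (t : ℝ) : IsCentered (ball (0 : E) t) := by
  intro x hx y hyx
  rw [mem_ball_zero_iff] at hx ⊢
  exact hyx.trans_lt hx

theorem isCentered_lt_of_norm_antitone {α : Type*} [Preorder α] {g : E → α}
    (hg : ∀ x y, ‖x‖ ≤ ‖y‖ → g y ≤ g x) (s : α) : IsCentered {x | s < g x} :=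
  fun x hx y hyx => lt_of_lt_of_le hx (hg y x hyx)

theorem IsCentered.norm_preimage_lowerClosure {A : Set E} (hA : IsCentered A) :
    norm ⁻¹' (lowerClosure (norm '' A) : Set ℝ) = A := by
  ext y
  simp only [mem_preimage, SetLike.mem_coe, mem_lowerClosure, exists_mem_image]
  exact ⟨fun ⟨_, hx, hyx⟩ => hA hx hyx, fun hy => ⟨y, hy, le_rfl⟩⟩

theorem preimage_smul_closedBall_of_ne_zero {𝕜 : Type*} [NormedField 𝕜] [NormedSpace 𝕜 E] {c : 𝕜}
    (hc : c ≠ 0) (x : E) (t : ℝ) :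
    (fun y => c • y) ⁻¹' closedBall x t = closedBall (c⁻¹ • x) (t / ‖c‖) := by
  ext y
  have hdist : c • y - x = c • (y - c⁻¹ • x) := by rw [smul_sub, smul_inv_smul₀ hc]
  rw [mem_preimage, mem_closedBall_iff_norm, mem_closedBall_iff_norm, hdist, norm_smul,
    le_div_iff₀' (norm_pos_iff.2 hc)]

variable [MeasurableSpace E]

/-- Birnbaum's peakedness order: `μ` is at least as peaked about `0` as `μ'`. -/
def PeakedLE (μ' μ : Measure E) : Prop := ∀ t, μ' (closedBall 0 t) ≤ μ (closedBall 0 t)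

/-- The mass of a ball of given radius decreases as its centre moves away from `0`. This form of
unimodality does not require a density, so that it includes the Dirac mass at `0`. -/
def CenteredDecreasing (μ : Measure E) : Prop :=
  ∀ t x y, ‖x‖ ≤ ‖y‖ → μ (closedBall y t) ≤ μ (closedBall x t)

variable {μ μ' ν ν' : Measure E}

theorem CenteredDecreasing.measureReal_le [IsFiniteMeasure μ] (hμ : CenteredDecreasing μ)
    (t : ℝ) (x y : E) (hxy : ‖x‖ ≤ ‖y‖) :
    μ.real (closedBall y t) ≤ μ.real (closedBall x t) :=
  ENNReal.toReal_mono (measure_ne_top _ _) (hμ t x y hxy)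

section OpensMeasurable

variable [OpensMeasurableSpace E]

theorem IsCentered.measurableSet {A : Set E} (hA : IsCentered A) : MeasurableSet A := by
  rw [← hA.norm_preimage_lowerClosure]
  exact continuous_norm.measurable (lowerClosure _).lower.ordConnected.measurableSet

theorem measurable_of_norm_antitone {g : E → ℝ} (hg : ∀ x y, ‖x‖ ≤ ‖y‖ → g y ≤ g x) :
    Measurable g :=
  measurable_of_Ioi fun s => (isCentered_lt_of_norm_antitone hg s).measurableSet

theorem PeakedLE.measure_le [IsFiniteMeasure μ'] (h : PeakedLE μ' μ) {A : Set E}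
    (hA : IsCentered A) : μ' A ≤ μ A := by
  have hB := (lowerClosure (norm '' A)).lower.ordConnected.measurableSet
  have hmap := Measure.map_apply (μ := μ') continuous_norm.measurable hB
  rw [hA.norm_preimage_lowerClosure] at hmap
  rw [← hmap, hB.measure_eq_iSup_isCompact]
  refine iSup₂_le fun K hKB => iSup_le fun hK => ?_
  rcases K.eq_empty_or_nonempty with rfl | hne
  · simp
  obtain ⟨r, hrK, hr⟩ := hK.exists_isGreatest hne
  obtain ⟨_, ⟨x, hxA, rfl⟩, hrx⟩ := hKB hrK
  calc μ'.map norm K = μ' (norm ⁻¹' K) :=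
        Measure.map_apply continuous_norm.measurable hK.measurableSet
    _ ≤ μ' (closedBall 0 r) := measure_mono fun y hy => mem_closedBall_zero_iff.2 (hr hy)
    _ ≤ μ (closedBall 0 r) := h r
    _ ≤ μ A := measure_mono fun y hy => hA hxA ((mem_closedBall_zero_iff.1 hy).trans hrx)

theorem lintegral_ofReal_mono_of_measure_lt {α : Type*} [MeasurableSpace α] {ρ' ρ : Measure α}
    {g : α → ℝ} (hg : Measurable g) (h0 : 0 ≤ g) (h : ∀ s, ρ' {x | s < g x} ≤ ρ {x | s < g x}) :
    ∫⁻ x, ENNReal.ofReal (g x) ∂ρ' ≤ ∫⁻ x, ENNReal.ofReal (g x) ∂ρ := by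
  rw [lintegral_eq_lintegral_meas_lt ρ' (.of_forall h0) hg.aemeasurable,
    lintegral_eq_lintegral_meas_lt ρ (.of_forall h0) hg.aemeasurable]
  exact lintegral_mono fun s => h s

theorem PeakedLE.lintegral_le [IsFiniteMeasure μ'] (h : PeakedLE μ' μ)
    {g : E → ℝ} (h0 : 0 ≤ g) (hg : ∀ x y, ‖x‖ ≤ ‖y‖ → g y ≤ g x) :
    ∫⁻ x, ENNReal.ofReal (g x) ∂μ' ≤ ∫⁻ x, ENNReal.ofReal (g x) ∂μ :=
  lintegral_ofReal_mono_of_measure_lt (measurable_of_norm_antitone hg) h0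
    fun s => h.measure_le (isCentered_lt_of_norm_antitone hg s)

theorem centeredDecreasing_dirac_zero : CenteredDecreasing (Measure.dirac (0 : E)) := by
  intro t x y hxy
  rw [Measure.dirac_apply' _ measurableSet_closedBall,
    Measure.dirac_apply' _ measurableSet_closedBall]
  by_cases hy : (0 : E) ∈ closedBall y t
  · have hx : (0 : E) ∈ closedBall x t := by
      rw [mem_closedBall, dist_zero_left] at hy ⊢
      exact hxy.trans hy
    rw [indicator_of_mem hx]
    exact indicator_le_self' (fun _ _ => zero_le) _
  · rw [indicator_of_notMem hy]
    exact zero_le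

end OpensMeasurable

variable [BorelSpace E]

theorem map_const_sub_closedBall_zero (x : E) (t : ℝ) :
    (μ.map fun y => x - y) (closedBall 0 t) = μ (closedBall x t) := by
  rw [Measure.map_apply (by fun_prop) measurableSet_closedBall]
  congr 1 with y
  simp [dist_eq_norm, norm_sub_rev]

section Convolution

variable [SecondCountableTopology E]

theorem conv_closedBall [SFinite ν] (x : E) (t : ℝ) :
    (μ.conv ν) (closedBall x t) = ∫⁻ y, ν (closedBall (x - y) t) ∂μ := by
  rw [← lintegral_indicator_one measurableSet_closedBall,
    Measure.lintegral_conv (measurable_one.indicator measurableSet_closedBall)]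
  refine lintegral_congr fun y => ?_
  rw [← lintegral_indicator_one measurableSet_closedBall]
  refine lintegral_congr fun z => ?_
  simp only [indicator, mem_closedBall, dist_eq_norm, sub_sub_eq_add_sub, add_comm z y,
    Pi.one_apply]

theorem CenteredDecreasing.conv_closedBall_le [IsFiniteMeasure μ'] [IsFiniteMeasure ν]
    (hν : CenteredDecreasing ν) {x x' : E}
    (h : ∀ s, μ' (closedBall x' s) ≤ μ (closedBall x s)) (t : ℝ) :
    (μ'.conv ν) (closedBall x' t) ≤ (μ.conv ν) (closedBall x t) := by
  have hmeas := measurable_of_norm_antitone (hν.measureReal_le t)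
  have hconv (ρ : Measure E) (z : E) : (ρ.conv ν) (closedBall z t) =
      ∫⁻ y, ENNReal.ofReal (ν.real (closedBall y t)) ∂(ρ.map fun y => z - y) := by
    rw [conv_closedBall, lintegral_map hmeas.ennreal_ofReal (by fun_prop)]
    exact lintegral_congr fun y => (ofReal_measureReal).symm
  have hpeaked : PeakedLE (μ'.map fun y => x' - y) (μ.map fun y => x - y) := fun s => by
    simpa only [map_const_sub_closedBall_zero] using h s
  rw [hconv, hconv]
  exact hpeaked.lintegral_le (fun _ => measureReal_nonneg) (hν.measureReal_le t)

theorem CenteredDecreasing.conv [IsFiniteMeasure μ] [IsFiniteMeasure ν]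
    (hμ : CenteredDecreasing μ) (hν : CenteredDecreasing ν) : CenteredDecreasing (μ.conv ν) :=
  fun t x y hxy => hν.conv_closedBall_le (fun s => hμ s x y hxy) t

theorem PeakedLE.conv [IsFiniteMeasure μ] [IsFiniteMeasure μ'] [IsFiniteMeasure ν]
    [IsFiniteMeasure ν'] (h : PeakedLE μ' μ) (h' : PeakedLE ν' ν)
    (hμ : CenteredDecreasing μ) (hν' : CenteredDecreasing ν') :
    PeakedLE (μ'.conv ν') (μ.conv ν) := by
  intro t
  calc (μ'.conv ν') (closedBall 0 t) ≤ (μ.conv ν') (closedBall 0 t) :=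
        hν'.conv_closedBall_le h t
    _ = (ν'.conv μ) (closedBall 0 t) := by rw [Measure.conv_comm]
    _ ≤ (ν.conv μ) (closedBall 0 t) := hμ.conv_closedBall_le h' t
    _ = (μ.conv ν) (closedBall 0 t) := by rw [Measure.conv_comm]

end Convolution

section Scaling

variable {𝕜 : Type*} [NormedField 𝕜] [NormedSpace 𝕜 E]

theorem CenteredDecreasing.map_smul [IsProbabilityMeasure μ] (hμ : CenteredDecreasing μ) (c : 𝕜) :
    CenteredDecreasing (μ.map fun x => c • x) := by
  rcases eq_or_ne c 0 with rfl | hc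
  · simpa using centeredDecreasing_dirac_zero
  intro t x y hxy
  rw [Measure.map_apply (by fun_prop) measurableSet_closedBall,
    Measure.map_apply (by fun_prop) measurableSet_closedBall,
    preimage_smul_closedBall_of_ne_zero hc, preimage_smul_closedBall_of_ne_zero hc]
  refine hμ _ _ _ ?_
  rw [norm_smul, norm_smul]
  gcongr

theorem PeakedLE.map_smul [IsFiniteMeasure μ'] (h : PeakedLE μ' μ) {c c' : 𝕜}
    (hc : ‖c'‖ = ‖c‖) : PeakedLE (μ'.map fun x => c' • x) (μ.map fun x => c • x) := by
  intro t
  have hpreimage :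
      (fun x : E => c' • x) ⁻¹' closedBall 0 t = (fun x => c • x) ⁻¹' closedBall 0 t := by
    ext x
    simp only [mem_preimage, mem_closedBall_zero_iff, norm_smul, hc]
  rw [Measure.map_apply (by fun_prop) measurableSet_closedBall,
    Measure.map_apply (by fun_prop) measurableSet_closedBall, hpreimage]
  refine h.measure_le fun x hx y hyx => ?_
  rw [mem_preimage, mem_closedBall_zero_iff, norm_smul] at hx ⊢
  exact hx.trans' (by gcongr)

end Scaling

end Peakedness

section FiniteConvolutions

instance isProbabilityMeasure_convN : ∀ (N : ℕ) (ν : Fin N → Measure ℝ)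
    [∀ i, IsProbabilityMeasure (ν i)], IsProbabilityMeasure (convN N ν)
  | 0, _, _ => by unfold convN; infer_instance
  | n + 1, ν, _ => by
    have := isProbabilityMeasure_convN n fun i => ν i.succ
    unfold convN; infer_instance

theorem centeredDecreasing_convN : ∀ (N : ℕ) (ν : Fin N → Measure ℝ)
    [∀ i, IsProbabilityMeasure (ν i)], (∀ i, CenteredDecreasing (ν i)) →
    CenteredDecreasing (convN N ν)
  | 0, _, _, _ => centeredDecreasing_dirac_zero
  | n + 1, _, _, h => (h 0).conv (centeredDecreasing_convN n _ fun i => h i.succ)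

theorem peakedLE_convN : ∀ (N : ℕ) (ν' ν : Fin N → Measure ℝ)
    [∀ i, IsProbabilityMeasure (ν' i)] [∀ i, IsProbabilityMeasure (ν i)],
    (∀ i, CenteredDecreasing (ν' i)) → (∀ i, CenteredDecreasing (ν i)) →
    (∀ i, PeakedLE (ν' i) (ν i)) → PeakedLE (convN N ν') (convN N ν)
  | 0, _, _, _, _, _, _, _ => fun _ => le_rfl
  | n + 1, _, _, _, _, hν', hν, h =>
    (h 0).conv (peakedLE_convN n _ _ (fun i => hν' i.succ) (fun i => hν i.succ)
      fun i => h i.succ) (hν 0) (centeredDecreasing_convN n _ fun i => hν' i.succ)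

theorem map_sum_eq_convN {Ω : Type*} [MeasurableSpace Ω] (P : Measure Ω)
    [IsProbabilityMeasure P] : ∀ (N : ℕ) (X : Fin N → Ω → ℝ), (∀ i, AEMeasurable (X i) P) →
    iIndepFun X P → P.map (∑ i, X i) = convN N fun i => P.map (X i)
  | 0, X, _, _ => by simp [convN, Pi.zero_def]
  | n + 1, X, hX, hind => by
    have htail := map_sum_eq_convN P n (fun i => X i.succ) (fun i => hX _)
      (hind.precomp (Fin.succ_injective n))
    have hhead : IndepFun (X 0) (∑ i : Fin n, X i.succ) P := by
      have := hind.indepFun_finsetSum_of_notMem₀ hX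
        (s := Finset.univ.map (Fin.succEmb n)) (i := 0) (by simp)
      simpa only [Finset.sum_map, Fin.coe_succEmb] using this.symm
    rw [convN, ← htail, Fin.sum_univ_succ,
      hhead.map_add_eq_map_conv_map₀ (hX 0) (Finset.aemeasurable_sum _ fun i _ => hX i.succ)]

end FiniteConvolutions

section CenteredOnLine

variable {μ ν : Measure ℝ}

theorem CenteredDecreasing.isNegInvariant [IsFiniteMeasure μ] (hμ : CenteredDecreasing μ) :
    μ.IsNegInvariant := by
  refine ⟨Measure.ext_of_Icc _ _ fun a b _ => ?_⟩
  have hball : μ (closedBall (-((a + b) / 2)) ((b - a) / 2)) =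
      μ (closedBall ((a + b) / 2) ((b - a) / 2)) :=
    le_antisymm (hμ _ _ _ (norm_neg _).ge) (hμ _ _ _ (norm_neg _).le)
  rw [Real.closedBall_eq_Icc, Real.closedBall_eq_Icc] at hball
  rw [Measure.neg_apply, neg_Icc]
  convert hball using 2 <;> congr 1 <;> ring

theorem measureReal_Ici_neg [μ.IsNegInvariant] (x : ℝ) : μ.real (Ici (-x)) = μ.real (Iic x) := by
  rw [measureReal_def, measureReal_def, ← Measure.measure_neg μ (Iic x), neg_Iic]

theorem two_mul_cdf_of_nonneg [IsProbabilityMeasure μ] [μ.IsNegInvariant] {x : ℝ} (hx : 0 ≤ x) :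
    2 * cdf μ x = 1 + μ.real (closedBall 0 x) := by
  have hunion : Iic x ∪ Ici (-x) = univ := Iic_union_Ici_of_le (by linarith)
  have hinter : Iic x ∩ Ici (-x) = closedBall 0 x := by
    rw [inter_comm, Ici_inter_Iic, Real.closedBall_eq_Icc, zero_sub, zero_add]
  have hsum := measureReal_union_add_inter (μ := μ) (s := Iic x) (t := Ici (-x)) measurableSet_Ici
  rw [hunion, hinter, measureReal_Ici_neg, probReal_univ] at hsum
  rw [cdf_eq_real]
  linarith

theorem two_mul_cdf_of_neg [IsProbabilityMeasure μ] [μ.IsNegInvariant] {x : ℝ} (hx : x < 0) :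
    2 * cdf μ x = 1 - μ.real (ball 0 (-x)) := by
  have hdisj : Disjoint (Iic x) (Ici (-x)) := (Iic_disjoint_Ici).2 (by linarith)
  have hcompl : (ball (0 : ℝ) (-x))ᶜ = Iic x ∪ Ici (-x) := by
    rw [Real.ball_eq_Ioo, zero_sub, neg_neg, zero_add, ← Ioi_inter_Iio, compl_inter, compl_Ioi,
      compl_Iio]
  have hsum := probReal_compl_eq_one_sub (μ := μ) (measurableSet_ball (x := (0 : ℝ)) (ε := -x))
  rw [hcompl, measureReal_union hdisj measurableSet_Ici, measureReal_Ici_neg] at hsum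
  rw [cdf_eq_real]
  linarith

theorem peakedLE_of_cdf_le [IsProbabilityMeasure μ] [IsProbabilityMeasure ν] [μ.IsNegInvariant]
    [ν.IsNegInvariant] (h : ∀ x, 0 ≤ x → cdf ν x ≤ cdf μ x) : PeakedLE ν μ := by
  intro t
  rcases lt_or_ge t 0 with ht | ht
  · rw [closedBall_eq_empty.2 ht, measure_empty]
    exact zero_le
  · rw [← ENNReal.toReal_le_toReal (measure_ne_top _ _) (measure_ne_top _ _)]
    linarith [h t ht, two_mul_cdf_of_nonneg (μ := μ) ht, two_mul_cdf_of_nonneg (μ := ν) ht,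
      measureReal_def μ (closedBall 0 t), measureReal_def ν (closedBall 0 t)]

theorem PeakedLE.overbounds [IsProbabilityMeasure μ] [IsProbabilityMeasure ν] [μ.IsNegInvariant]
    [ν.IsNegInvariant] (h : PeakedLE ν μ) : Overbounds (cdf ν) (cdf μ) := by
  constructor <;> intro x hx <;> rcases lt_or_ge x 0 with hneg | hnonneg
  · have hball : ν.real (ball 0 (-x)) ≤ μ.real (ball 0 (-x)) :=
      ENNReal.toReal_mono (measure_ne_top _ _) (h.measure_le (isCentered_ball_zero _))
    linarith [two_mul_cdf_of_neg (μ := μ) hneg, two_mul_cdf_of_neg (μ := ν) hneg]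
  · linarith [two_mul_cdf_of_nonneg (μ := ν) hnonneg, measureReal_nonneg (μ := ν)
      (s := closedBall 0 x)]
  · linarith [two_mul_cdf_of_neg (μ := μ) hneg, measureReal_nonneg (μ := μ) (s := ball 0 (-x))]
  · have hball : ν.real (closedBall 0 x) ≤ μ.real (closedBall 0 x) :=
      ENNReal.toReal_mono (measure_ne_top _ _) (h x)
    linarith [two_mul_cdf_of_nonneg (μ := μ) hnonneg, two_mul_cdf_of_nonneg (μ := ν) hnonneg]

theorem min_add_min_sub_le_of_abs_le {s t x y : ℝ} (hxy : |x| ≤ |y|) :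
    min s (t + y) + min s (t - y) ≤ min s (t + x) + min s (t - x) := by
  grind

theorem centeredDecreasing_volume_inter (s t : ℝ) {x y : ℝ} (hxy : ‖x‖ ≤ ‖y‖) :
    volume (closedBall 0 s ∩ closedBall y t) ≤ volume (closedBall 0 s ∩ closedBall x t) := by
  have hvolume (z : ℝ) : volume (closedBall 0 s ∩ closedBall z t) =
      ENNReal.ofReal (min s (t + z) + min s (t - z)) := by
    rw [Real.closedBall_eq_Icc, Real.closedBall_eq_Icc, Icc_inter_Icc, Real.volume_Icc, zero_add,
      zero_sub, ← neg_sub t z, max_neg_neg, sub_neg_eq_add, add_comm t z]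
  rw [hvolume, hvolume]
  exact ENNReal.ofReal_le_ofReal (min_add_min_sub_le_of_abs_le hxy)

theorem IsSymmUnimodal.centeredDecreasing (h : IsSymmUnimodal μ) : CenteredDecreasing μ := by
  obtain ⟨f, hf, h0, heven, hanti, rfl⟩ := h
  intro t x y hxy
  have hpeaked : PeakedLE (volume.restrict (closedBall y t)) (volume.restrict (closedBall x t)) :=
    fun s => by
      rw [Measure.restrict_apply measurableSet_closedBall,
        Measure.restrict_apply measurableSet_closedBall]
      exact centeredDecreasing_volume_inter s t hxy
  have habs (a : ℝ) : f |a| = f a := by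
    rcases abs_choice a with h | h <;> rw [h]
    exact heven a
  -- The value of `f` at `0` is arbitrary, so that its superlevel sets are centered only up to `0`.
  have hcentered (s : ℝ) : IsCentered (insert 0 {z | s < f z}) := by
    rintro a (rfl | ha) b hb
    · exact .inl (norm_le_zero_iff.1 (hb.trans_eq norm_zero))
    · refine or_iff_not_imp_left.2 fun hb0 => ?_
      have hbpos : 0 < |b| := abs_pos.2 hb0
      calc s < f |a| := by rwa [habs]
        _ ≤ f |b| := hanti hbpos (hbpos.trans_le hb) hb
        _ = f b := habs b
  have hfinite : IsFiniteMeasure (volume.restrict (closedBall y t)) :=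
    isFiniteMeasure_restrict.2 measure_closedBall_lt_top.ne
  rw [withDensity_apply _ measurableSet_closedBall, withDensity_apply _ measurableSet_closedBall]
  refine lintegral_ofReal_mono_of_measure_lt hf h0 fun s => ?_
  calc _ ≤ _ := measure_mono (subset_insert 0 _)
    _ ≤ _ := hpeaked.measure_le (hcentered s)
    _ = _ := measure_congr (insert_ae_eq_self 0 _)

end CenteredOnLine

section Cdf

theorem cdf_neg {μ : Measure ℝ} [IsProbabilityMeasure μ] [μ.IsNegInvariant] [NullSingletonClass μ]
    (x : ℝ) : cdf μ (-x) = 1 - cdf μ x := by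
  have hcompl := probReal_compl_eq_one_sub (μ := μ) (measurableSet_Iic (a := -x))
  rw [compl_Iic, measureReal_congr Ioi_ae_eq_Ici, measureReal_Ici_neg] at hcompl
  rw [cdf_eq_real, cdf_eq_real]
  linarith

theorem measure_Ioc_eq_ofReal_cdf_sub (μ : Measure ℝ) [IsProbabilityMeasure μ] (a b : ℝ) :
    μ (Ioc a b) = ENNReal.ofReal (cdf μ b - cdf μ a) := by
  conv_lhs => rw [← measure_cdf μ]
  exact StieltjesFunction.measure_Ioc _ _ _

variable {f : ℝ → ℝ}

theorem concaveOn_cdf_withDensity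
    [IsProbabilityMeasure (volume.withDensity fun x => ENNReal.ofReal (f x))] {s : Set ℝ}
    (hs : Convex ℝ s) (h0 : ∀ x ∈ s, 0 ≤ f x) (hf : AntitoneOn f s) :
    ConcaveOn ℝ s (cdf (volume.withDensity fun x => ENNReal.ofReal (f x))) := by
  set μ := volume.withDensity fun x => ENNReal.ofReal (f x) with hμ
  have hsubset {a b : ℝ} (ha : a ∈ s) (hb : b ∈ s) : Ioc a b ⊆ s :=
    Ioc_subset_Icc_self.trans (hs.ordConnected.out ha hb)
  have hconst (c a b : ℝ) (hc : 0 ≤ c) :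
      ∫⁻ _ in Ioc a b, ENNReal.ofReal c = ENNReal.ofReal (c * (b - a)) := by
    rw [setLIntegral_const, Real.volume_Ioc, ENNReal.ofReal_mul hc]
  have hlower {a b : ℝ} (ha : a ∈ s) (hb : b ∈ s) (hab : a < b) :
      f b * (b - a) ≤ cdf μ b - cdf μ a := by
    refine (ENNReal.ofReal_le_ofReal_iff (sub_nonneg.2 (monotone_cdf μ hab.le))).1 ?_
    rw [← measure_Ioc_eq_ofReal_cdf_sub, ← hconst _ _ _ (h0 b hb), hμ,
      withDensity_apply _ measurableSet_Ioc]
    exact setLIntegral_mono' measurableSet_Ioc fun x hx =>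
      ENNReal.ofReal_le_ofReal (hf (hsubset ha hb hx) hb hx.2)
  have hupper {a b : ℝ} (ha : a ∈ s) (hb : b ∈ s) (hab : a < b) :
      cdf μ b - cdf μ a ≤ f a * (b - a) := by
    refine (ENNReal.ofReal_le_ofReal_iff (mul_nonneg (h0 a ha) (sub_nonneg.2 hab.le))).1 ?_
    rw [← measure_Ioc_eq_ofReal_cdf_sub, ← hconst _ _ _ (h0 a ha), hμ,
      withDensity_apply _ measurableSet_Ioc]
    exact setLIntegral_mono measurable_const fun x hx =>
      ENNReal.ofReal_le_ofReal (hf ha (hsubset ha hb hx) hx.1.le)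
  refine concaveOn_of_slope_anti_adjacent hs fun {a b c} ha hc hab hbc => ?_
  have hb : b ∈ s := hs.ordConnected.out ha hc ⟨hab.le, hbc.le⟩
  calc (cdf μ c - cdf μ b) / (c - b) ≤ f b := (div_le_iff₀ (sub_pos.2 hbc)).2 (hupper hb hc hbc)
    _ ≤ (cdf μ b - cdf μ a) / (b - a) := (le_div_iff₀ (sub_pos.2 hab)).2 (hlower ha hb hab)

theorem IsSymmUnimodal.concaveOn_cdf {μ : Measure ℝ} [hprob : IsProbabilityMeasure μ]
    (hμ : IsSymmUnimodal μ) : ConcaveOn ℝ (Ioi 0) (cdf μ) := by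
  obtain ⟨f, -, h0, -, hanti, rfl⟩ := hμ
  exact concaveOn_cdf_withDensity (convex_Ioi 0) (fun x _ => h0 x) hanti

theorem withDensity_ofReal_Ioc (hf : Continuous f) (h0 : ∀ x, 0 ≤ f x) {a b : ℝ} (hab : a ≤ b) :
    volume.withDensity (fun x => ENNReal.ofReal (f x)) (Ioc a b) =
      ENNReal.ofReal (∫ x in a..b, f x) := by
  rw [withDensity_apply _ measurableSet_Ioc, intervalIntegral.integral_of_le hab,
    ofReal_integral_eq_lintegral_ofReal hf.integrableOn_Ioc (.of_forall h0)]

theorem hasDerivAt_cdf_withDensity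
    [IsProbabilityMeasure (volume.withDensity fun x => ENNReal.ofReal (f x))]
    (hf : Continuous f) (h0 : ∀ x, 0 ≤ f x) (x : ℝ) :
    HasDerivAt (cdf (volume.withDensity fun x => ENNReal.ofReal (f x))) (f x) x := by
  set μ := volume.withDensity fun x => ENNReal.ofReal (f x) with hμ
  have hincrement {a b : ℝ} (hab : a ≤ b) : cdf μ b - cdf μ a = ∫ x in a..b, f x := by
    have hIoc := measure_Ioc_eq_ofReal_cdf_sub μ a b
    rw [hμ, withDensity_ofReal_Ioc hf h0 hab] at hIoc
    exact ((ENNReal.ofReal_eq_ofReal_iff (intervalIntegral.integral_nonneg hab fun x _ => h0 x)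
      (sub_nonneg.2 (monotone_cdf μ hab))).1 hIoc).symm
  have hprimitive : (cdf μ : ℝ → ℝ) = fun y => cdf μ 0 + ∫ x in (0 : ℝ)..y, f x := by
    ext y
    rcases le_total 0 y with h | h
    · rw [← hincrement h, add_sub_cancel]
    · rw [intervalIntegral.integral_symm, ← hincrement h, neg_sub, add_sub_cancel]
  rw [hprimitive]
  exact (hf.integral_hasStrictDerivAt 0 x).hasDerivAt.const_add _

theorem isProbabilityMeasure_withDensity_and_cdf_eq {F : ℝ → ℝ} (hf : Continuous f)
    (h0 : ∀ x, 0 ≤ f x) (hF : ∀ x, HasDerivAt F (f x) x) (hbot : Tendsto F atBot (𝓝 0))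
    (htop : Tendsto F atTop (𝓝 1)) :
    IsProbabilityMeasure (volume.withDensity fun x => ENNReal.ofReal (f x)) ∧
      ∀ x, cdf (volume.withDensity fun x => ENNReal.ofReal (f x)) x = F x := by
  let G : StieltjesFunction ℝ :=
    ⟨F, monotone_of_hasDerivAt_nonneg hF h0, fun x => (hF x).continuousAt.continuousWithinAt⟩
  have hG : volume.withDensity (fun x => ENNReal.ofReal (f x)) = G.measure := by
    refine (Measure.ext_of_Ioc _ _ fun a b hab => ?_).symm
    rw [StieltjesFunction.measure_Ioc, withDensity_ofReal_Ioc hf h0 hab.le,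
      intervalIntegral.integral_eq_sub_of_hasDerivAt (fun x _ => hF x)
        (hf.intervalIntegrable _ _)]
  rw [hG, cdf_measure_stieltjesFunction G hbot htop]
  exact ⟨⟨by rw [G.measure_univ hbot htop, sub_zero, ENNReal.ofReal_one]⟩, fun _ => rfl⟩

end Cdf

theorem lt_tangent_of_strictAntiOn {F f : ℝ → ℝ} {s : Set ℝ} (hs : Convex ℝ s)
    (hF : ∀ x ∈ s, HasDerivAt F (f x) x) (hf : StrictAntiOn f s) {x y : ℝ} (hx : x ∈ s)
    (hy : y ∈ s) (hyx : y ≠ x) : F y < f x * (y - x) + F x := by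
  have hcont : ContinuousOn F s := fun z hz => (hF z hz).continuousAt.continuousWithinAt
  have hconcave : StrictConcaveOn ℝ s F :=
    StrictAntiOn.strictConcaveOn_of_deriv hs hcont <| (hf.mono interior_subset).congr fun z hz =>
      (hF z (interior_subset hz)).deriv.symm
  rcases lt_or_gt_of_ne hyx with h | h
  · have hslope := hconcave.lt_slope_of_hasDerivAt hy hx h (hF x hx)
    rw [slope_def_field, lt_div_iff₀ (sub_pos.2 h)] at hslope
    linarith
  · have hslope := hconcave.slope_lt_of_hasDerivAt hx hy h (hF x hx)
    rw [slope_def_field, div_lt_iff₀ (sub_pos.2 h)] at hslope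
    linarith

section Cauchy

variable {lam : ℝ}

theorem fC_eq_one_div (x : ℝ) : fC lam x = 1 / (lam * Real.pi * (1 + (x / lam) ^ 2)) := by
  rw [fC, one_div_mul_one_div]

theorem fC_denom_pos (hl : 0 < lam) (x : ℝ) : 0 < lam * Real.pi * (1 + (x / lam) ^ 2) := by
  positivity

theorem fC_pos (hl : 0 < lam) (x : ℝ) : 0 < fC lam x := by
  rw [fC_eq_one_div]
  exact one_div_pos.2 (fC_denom_pos hl x)

theorem fC_neg (x : ℝ) : fC lam (-x) = fC lam x := by
  rw [fC, fC, neg_div, neg_sq]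

theorem fC_lt_fC_iff (hl : 0 < lam) {x y : ℝ} : fC lam x < fC lam y ↔ |y| < |x| := by
  rw [fC_eq_one_div, fC_eq_one_div, one_div_lt_one_div (fC_denom_pos hl x) (fC_denom_pos hl y),
    mul_lt_mul_iff_right₀ (by positivity), add_lt_add_iff_left, sq_lt_sq, abs_div, abs_div,
    div_lt_div_iff_of_pos_right (abs_pos.2 hl.ne')]

theorem fC_le_fC_iff (hl : 0 < lam) {x y : ℝ} : fC lam x ≤ fC lam y ↔ |y| ≤ |x| := by
  rw [← not_lt, fC_lt_fC_iff hl, not_lt]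

theorem fC_strictAntiOn (hl : 0 < lam) : StrictAntiOn (fC lam) (Ici 0) := fun x hx y hy hxy => by
  rwa [fC_lt_fC_iff hl, abs_of_nonneg hx, abs_of_nonneg hy]

theorem continuous_fC (hl : 0 < lam) : Continuous (fC lam) := by
  simp only [funext fC_eq_one_div]
  exact continuous_const.div (by fun_prop) fun x => (fC_denom_pos hl x).ne'

theorem FC_zero : FC lam 0 = 1 / 2 := by
  rw [FC, zero_div, Real.arctan_zero, mul_zero, add_zero]

theorem FC_neg (x : ℝ) : FC lam (-x) = 1 - FC lam x := by
  rw [FC, FC, neg_div, Real.arctan_neg]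
  ring

theorem hasDerivAt_FC (x : ℝ) : HasDerivAt (FC lam) (fC lam x) x := by
  refine (((hasDerivAt_id x).div_const lam).arctan.const_mul (1 / Real.pi)).const_add (1 / 2)
    |>.congr_deriv ?_
  rw [fC, id, mul_left_comm, one_div_mul_one_div, mul_comm Real.pi, mul_comm]

theorem continuous_FC : Continuous (FC lam) :=
  continuous_iff_continuousAt.2 fun x => (hasDerivAt_FC x).continuousAt

theorem tendsto_FC_atTop (hl : 0 < lam) : Tendsto (FC lam) atTop (𝓝 1) := by
  have harctan : Tendsto (fun x => Real.arctan (x / lam)) atTop (𝓝 (Real.pi / 2)) :=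
    (Real.tendsto_arctan_atTop.mono_right nhdsWithin_le_nhds).comp (tendsto_id.atTop_div_const hl)
  have hlimit : 1 / 2 + 1 / Real.pi * (Real.pi / 2) = 1 := by
    field_simp
    norm_num
  exact hlimit ▸ (harctan.const_mul (1 / Real.pi)).const_add (1 / 2)

theorem FC_lt_tangent (hl : 0 < lam) {x y : ℝ} (hx : 0 ≤ x) (hy : 0 ≤ y) (hyx : y ≠ x) :
    FC lam y < fC lam x * (y - x) + FC lam x :=
  lt_tangent_of_strictAntiOn (convex_Ici 0) (fun z _ => hasDerivAt_FC z) (fC_strictAntiOn hl)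
    hx hy hyx

end Cauchy

section Gauss

variable {sig : ℝ}

theorem fG_eq_one_div (x : ℝ) :
    fG sig x = 1 / (√(2 * Real.pi * sig ^ 2) * Real.exp (x ^ 2 / (2 * sig ^ 2))) := by
  have hpdf : fG sig x = (√(2 * Real.pi * sig ^ 2))⁻¹ * Real.exp (-(x - 0) ^ 2 / (2 * sig ^ 2)) :=
    rfl
  rw [hpdf, one_div, mul_inv, ← Real.exp_neg, sub_zero, neg_div]

theorem fG_denom_pos (hs : 0 < sig) (x : ℝ) :
    0 < √(2 * Real.pi * sig ^ 2) * Real.exp (x ^ 2 / (2 * sig ^ 2)) := by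
  positivity

theorem fG_pos (hs : 0 < sig) (x : ℝ) : 0 < fG sig x := by
  rw [fG_eq_one_div]
  exact one_div_pos.2 (fG_denom_pos hs x)

theorem fG_neg (x : ℝ) : fG sig (-x) = fG sig x := by
  rw [fG_eq_one_div, fG_eq_one_div, neg_sq]

theorem fG_lt_fG_iff (hs : 0 < sig) {x y : ℝ} : fG sig x < fG sig y ↔ |y| < |x| := by
  rw [fG_eq_one_div, fG_eq_one_div, one_div_lt_one_div (fG_denom_pos hs x) (fG_denom_pos hs y),
    mul_lt_mul_iff_right₀ (by positivity), Real.exp_lt_exp,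
    div_lt_div_iff_of_pos_right (by positivity), sq_lt_sq]

theorem fG_le_fG_iff (hs : 0 < sig) {x y : ℝ} : fG sig x ≤ fG sig y ↔ |y| ≤ |x| := by
  rw [← not_lt, fG_lt_fG_iff hs, not_lt]

theorem fG_strictAntiOn (hs : 0 < sig) : StrictAntiOn (fG sig) (Ici 0) := fun x hx y hy hxy => by
  rwa [fG_lt_fG_iff hs, abs_of_nonneg hx, abs_of_nonneg hy]

theorem continuous_fG (hs : 0 < sig) : Continuous (fG sig) := by
  simp only [funext fG_eq_one_div]
  exact continuous_const.div (by fun_prop) fun x => (fG_denom_pos hs x).ne'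

theorem var_ne_zero (hs : 0 < sig) : (⟨sig ^ 2, sq_nonneg sig⟩ : NNReal) ≠ 0 :=
  fun h => (pow_pos hs 2).ne' (congrArg NNReal.toReal h)

theorem hasDerivAt_FG (hs : 0 < sig) (x : ℝ) : HasDerivAt (FG sig) (fG sig x) x := by
  have hdensity : gaussianReal 0 ⟨sig ^ 2, sq_nonneg sig⟩ =
      volume.withDensity fun x => ENNReal.ofReal (fG sig x) :=
    gaussianReal_of_var_ne_zero 0 (var_ne_zero hs)
  have hprob : IsProbabilityMeasure (volume.withDensity fun x => ENNReal.ofReal (fG sig x)) :=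
    hdensity ▸ instIsProbabilityMeasureGaussianReal 0 _
  unfold FG
  rw [hdensity]
  exact hasDerivAt_cdf_withDensity (continuous_fG hs) (fun x => (fG_pos hs x).le) x

theorem continuous_FG (hs : 0 < sig) : Continuous (FG sig) :=
  continuous_iff_continuousAt.2 fun x => (hasDerivAt_FG hs x).continuousAt

theorem FG_neg (hs : 0 < sig) (x : ℝ) : FG sig (-x) = 1 - FG sig x := by
  have hprob := instIsProbabilityMeasureGaussianReal 0 ⟨sig ^ 2, sq_nonneg sig⟩
  have hnull := nullSingletonClass_gaussianReal (μ := 0) (var_ne_zero hs)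
  have hneg : (gaussianReal 0 ⟨sig ^ 2, sq_nonneg sig⟩).IsNegInvariant :=
    ⟨gaussianReal_map_neg.trans (by rw [neg_zero])⟩
  exact cdf_neg x

theorem FG_zero (hs : 0 < sig) : FG sig 0 = 1 / 2 := by
  have hneg := FG_neg hs 0
  rw [neg_zero] at hneg
  linarith

theorem half_lt_FG (hs : 0 < sig) {x : ℝ} (hx : 0 < x) : 1 / 2 < FG sig x :=
  (FG_zero hs).symm.trans_lt (strictMono_of_hasDerivAt_pos (hasDerivAt_FG hs) (fG_pos hs) hx)

theorem tendsto_FG_atTop : Tendsto (FG sig) atTop (𝓝 1) := tendsto_cdf_atTop _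

theorem tendsto_FG_atBot : Tendsto (FG sig) atBot (𝓝 0) := tendsto_cdf_atBot _

theorem FG_lt_tangent (hs : 0 < sig) {x y : ℝ} (hx : 0 ≤ x) (hy : 0 ≤ y) (hyx : y ≠ x) :
    FG sig y < fG sig x * (y - x) + FG sig x :=
  lt_tangent_of_strictAntiOn (convex_Ici 0) (fun z _ => hasDerivAt_FG hs z) (fG_strictAntiOn hs)
    hx hy hyx

end Gauss

section Crossing

variable {lam sig : ℝ}

/-- The difference of the reciprocals of the Gaussian and Cauchy densities, as a function of the
square of the abscissa. It has the sign of `fC lam - fG sig` and, unlike this difference, it is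
strictly convex. -/
noncomputable def recipGap (lam sig t : ℝ) : ℝ :=
  √(2 * Real.pi * sig ^ 2) * Real.exp (t / (2 * sig ^ 2)) - lam * Real.pi * (1 + t / lam ^ 2)

theorem fC_le_fG_iff (hl : 0 < lam) (hs : 0 < sig) {x : ℝ} :
    fC lam x ≤ fG sig x ↔ recipGap lam sig (x ^ 2) ≤ 0 := by
  rw [fC_eq_one_div, fG_eq_one_div, one_div_le_one_div (fC_denom_pos hl x) (fG_denom_pos hs x),
    recipGap, sub_nonpos, div_pow]

theorem fC_lt_fG_iff (hl : 0 < lam) (hs : 0 < sig) {x : ℝ} :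
    fC lam x < fG sig x ↔ recipGap lam sig (x ^ 2) < 0 := by
  rw [fC_eq_one_div, fG_eq_one_div, one_div_lt_one_div (fC_denom_pos hl x) (fG_denom_pos hs x),
    recipGap, sub_neg, div_pow]

theorem fG_lt_fC_iff (hl : 0 < lam) (hs : 0 < sig) {x : ℝ} :
    fG sig x < fC lam x ↔ 0 < recipGap lam sig (x ^ 2) := by
  rw [← not_le, fC_le_fG_iff hl hs, not_le]

theorem strictConvexOn_recipGap (lam : ℝ) (hs : 0 < sig) :
    StrictConvexOn ℝ univ (recipGap lam sig) := by
  have hderiv (t : ℝ) : HasDerivAt (recipGap lam sig)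
      (√(2 * Real.pi * sig ^ 2) * (Real.exp (t / (2 * sig ^ 2)) * (1 / (2 * sig ^ 2))) -
        lam * Real.pi * (1 / lam ^ 2)) t :=
    ((((hasDerivAt_id t).div_const _).exp).const_mul _).sub
      ((((hasDerivAt_id t).div_const _).const_add 1).const_mul _)
  refine StrictMono.strictConvexOn_univ_of_deriv
    (continuous_iff_continuousAt.2 fun t => (hderiv t).continuousAt) fun u v huv => ?_
  rw [(hderiv u).deriv, (hderiv v).deriv]
  gcongr

theorem fC_lt_fG_of_mem_Ioo (hl : 0 < lam) (hs : 0 < sig) {a b c : ℝ} (ha0 : 0 ≤ a)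
    (hb : b ∈ Ioo a c) (ha : fC lam a ≤ fG sig a) (hc : fC lam c ≤ fG sig c) :
    fC lam b < fG sig b := by
  have hab : a ^ 2 < b ^ 2 := pow_lt_pow_left₀ hb.1 ha0 two_ne_zero
  have hbc : b ^ 2 < c ^ 2 := pow_lt_pow_left₀ hb.2 (ha0.trans hb.1.le) two_ne_zero
  rw [fC_le_fG_iff hl hs] at ha hc
  rw [fC_lt_fG_iff hl hs]
  calc recipGap lam sig (b ^ 2) < max (recipGap lam sig (a ^ 2)) (recipGap lam sig (c ^ 2)) :=
        (strictConvexOn_recipGap lam hs).lt_on_openSegment (mem_univ _) (mem_univ _)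
          (hab.trans hbc).ne (by rw [openSegment_eq_Ioo (hab.trans hbc)]; exact ⟨hab, hbc⟩)
    _ ≤ 0 := max_le ha hc

theorem eventually_fG_lt_fC (hl : 0 < lam) (hs : 0 < sig) : ∀ᶠ x in atTop, fG sig x < fC lam x := by
  have hlinear : (fun t => lam * Real.pi * (1 + t / lam ^ 2)) =o[atTop]
      fun t => √(2 * Real.pi * sig ^ 2) * Real.exp (t / (2 * sig ^ 2)) := by
    have hpow (k : ℕ) : (fun t : ℝ => t ^ k) =o[atTop] fun t => Real.exp ((2 * sig ^ 2)⁻¹ * t) :=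
      isLittleO_pow_exp_pos_mul_atTop k (by positivity)
    have hsum := ((hpow 0).add ((hpow 1).const_mul_left (lam ^ 2)⁻¹)).const_mul_left (lam * Real.pi)
    simpa only [pow_zero, pow_one, inv_mul_eq_div] using
      hsum.const_mul_right (c := √(2 * Real.pi * sig ^ 2)) (by positivity)
  filter_upwards [(tendsto_pow_atTop two_ne_zero).eventually
    (hlinear.def (c := 1 / 2) one_half_pos)] with x hx
  have hgauss := fG_denom_pos hs x
  rw [Real.norm_of_nonneg hgauss.le] at hx
  rw [fG_lt_fC_iff hl hs, recipGap, sub_pos]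
  linarith [Real.le_norm_self (lam * Real.pi * (1 + x ^ 2 / lam ^ 2))]

theorem hasDerivAt_FC_sub_FG (lam : ℝ) (hs : 0 < sig) (x : ℝ) :
    HasDerivAt (fun x => FC lam x - FG sig x) (fC lam x - fG sig x) x :=
  (hasDerivAt_FC x).sub (hasDerivAt_FG hs x)

theorem continuous_FC_sub_FG (lam : ℝ) (hs : 0 < sig) :
    Continuous fun x => FC lam x - FG sig x :=
  continuous_FC.sub (continuous_FG hs)

theorem tendsto_FC_sub_FG (hl : 0 < lam) :
    Tendsto (fun x => FC lam x - FG sig x) atTop (𝓝 0) :=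
  sub_self (1 : ℝ) ▸ (tendsto_FC_atTop hl).sub tendsto_FG_atTop

theorem FC_lt_FG_of_forall_fG_lt_fC (hl : 0 < lam) (hs : 0 < sig) {s : ℝ}
    (h : ∀ x, s < x → fG sig x < fC lam x) {x : ℝ} (hx : s ≤ x) : FC lam x < FG sig x := by
  have hmono : StrictMonoOn (fun x => FC lam x - FG sig x) (Ici s) := by
    refine strictMonoOn_of_hasDerivWithinAt_pos (convex_Ici s)
      (continuous_FC_sub_FG lam hs).continuousOn
      (fun y _ => (hasDerivAt_FC_sub_FG lam hs y).hasDerivWithinAt) fun y hy => ?_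
    rw [interior_Ici] at hy
    exact sub_pos.2 (h y hy)
  have hstep : FC lam x - FG sig x < FC lam (x + 1) - FG sig (x + 1) :=
    hmono hx (hx.trans (lt_add_one x).le) (lt_add_one x)
  have hlimit : FC lam (x + 1) - FG sig (x + 1) ≤ 0 := by
    refine ge_of_tendsto (tendsto_FC_sub_FG (sig := sig) hl) ?_
    filter_upwards [eventually_ge_atTop (x + 1)] with y hy
    have hsx : s ≤ x + 1 := hx.trans (lt_add_one x).le
    exact hmono.monotoneOn hsx (hsx.trans hy) hy
  exact sub_neg.1 (hstep.trans_le hlimit)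

theorem eventually_FC_lt_FG (hl : 0 < lam) (hs : 0 < sig) : ∀ᶠ x in atTop, FC lam x < FG sig x := by
  obtain ⟨s, hs'⟩ := eventually_atTop.1 (eventually_fG_lt_fC hl hs)
  filter_upwards [eventually_ge_atTop s] with x hx
  exact FC_lt_FG_of_forall_fG_lt_fC hl hs (fun y hy => hs' y hy.le) hx

theorem FC_lt_FG_of_le (hl : 0 < lam) (hs : 0 < sig) {u v : ℝ} (hu : 0 < u) (huv : u < v)
    (h : FC lam u ≤ FG sig u) : FC lam v < FG sig v := by
  by_contra! hv
  obtain ⟨a, ha, hslope_a⟩ := exists_hasDerivAt_eq_slope _ _ hu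
    (continuous_FC_sub_FG lam hs).continuousOn fun x _ => hasDerivAt_FC_sub_FG lam hs x
  obtain ⟨b, hb, hslope_b⟩ := exists_hasDerivAt_eq_slope _ _ huv
    (continuous_FC_sub_FG lam hs).continuousOn fun x _ => hasDerivAt_FC_sub_FG lam hs x
  have hfa : fC lam a ≤ fG sig a := by
    rw [← sub_nonpos, hslope_a, FC_zero, FG_zero hs, sub_self, sub_zero, sub_zero]
    exact div_nonpos_of_nonpos_of_nonneg (sub_nonpos.2 h) hu.le
  have hfb : fG sig b ≤ fC lam b := by
    rw [← sub_nonneg, hslope_b]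
    exact div_nonneg (by linarith) (sub_nonneg.2 huv.le)
  have htail (x : ℝ) (hx : b < x) : fG sig x < fC lam x := by
    by_contra! hfx
    exact (fC_lt_fG_of_mem_Ioo hl hs ha.1.le ⟨ha.2.trans hb.1, hx⟩ hfa hfx).not_ge hfb
  exact (FC_lt_FG_of_forall_fG_lt_fC hl hs htail hb.2.le).not_ge hv

theorem exists_mem_Ioo_hasDerivAt_eq_zero {D D' : ℝ → ℝ} {a b c : ℝ}
    (hcont : ContinuousOn D (Icc a b)) (hderiv : ∀ x ∈ Ioo a b, HasDerivAt D (D' x) x)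
    (hc : c ∈ Icc a b) (ha : D a < D c) (hb : D b < D c) : ∃ y ∈ Ioo a b, D c ≤ D y ∧ D' y = 0 := by
  obtain ⟨y, hy, hmax⟩ := isCompact_Icc.exists_isMaxOn ⟨c, hc⟩ hcont
  have hcy : D c ≤ D y := hmax hc
  have hay : a < y := hy.1.lt_of_ne fun h => (h ▸ ha).not_ge hcy
  have hyb : y < b := hy.2.lt_of_ne fun h => (h ▸ hb).not_ge hcy
  exact ⟨y, ⟨hay, hyb⟩, hcy,
    (hmax.isLocalMax (Icc_mem_nhds hay hyb)).hasDerivAt_eq_zero (hderiv y ⟨hay, hyb⟩)⟩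

theorem exists_fC_eq_fG_of_FG_lt_FC (hl : 0 < lam) (hs : 0 < sig) {x : ℝ} (hx : 0 < x)
    (h : FG sig x < FC lam x) :
    ∃ y z, 0 < y ∧ y < z ∧ fC lam y = fG sig y ∧ FG sig y < FC lam y ∧
      fC lam z = fG sig z ∧ FC lam z < FG sig z := by
  obtain ⟨t, hxt, ht⟩ := ((eventually_gt_atTop x).and (eventually_FC_lt_FG hl hs)).exists
  obtain ⟨y, hy, hFy, hfy⟩ := exists_mem_Ioo_hasDerivAt_eq_zero
    (continuous_FC_sub_FG lam hs).continuousOn (fun u _ => hasDerivAt_FC_sub_FG lam hs u)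
    (⟨hx.le, hxt.le⟩ : x ∈ Icc 0 t)
    (by rw [FC_zero, FG_zero hs, sub_self]; exact sub_pos.2 h) (by linarith)
  obtain ⟨u, htu, hu⟩ := ((eventually_gt_atTop t).and
    ((tendsto_FC_sub_FG (sig := sig) hl).eventually_const_lt (sub_neg.2 ht))).exists
  obtain ⟨z, hz, hFz, hfz⟩ := exists_mem_Ioo_hasDerivAt_eq_zero
    ((continuous_FG hs).sub continuous_FC).continuousOn
    (fun v _ => (hasDerivAt_FG hs v).sub (hasDerivAt_FC v)) (⟨hy.2.le, htu.le⟩ : t ∈ Icc y u)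
    (by simp only [Pi.sub_apply]; linarith) (by simp only [Pi.sub_apply]; linarith)
  simp only [Pi.sub_apply] at hFz
  exact ⟨y, z, hy.1, hz.1, by linarith, by linarith, by linarith, by linarith⟩

/-- The inverse on `(0, fC lam 0]` of the restriction of `fC lam` to the right half-line. For a
larger `k`, where there is none, the square root of a negative number makes it `0`. -/
noncomputable def fCInv (lam k : ℝ) : ℝ := lam * √(1 / (lam * Real.pi * k) - 1)

theorem fCInv_nonneg (hl : 0 ≤ lam) (k : ℝ) : 0 ≤ fCInv lam k := by
  unfold fCInv
  positivity

theorem fC_fCInv (hl : 0 < lam) {k : ℝ} (hk : 0 < k) (hk0 : k ≤ fC lam 0) :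
    fC lam (fCInv lam k) = k := by
  have hsqrt : 0 ≤ 1 / (lam * Real.pi * k) - 1 := by
    rw [fC_eq_one_div, zero_div, zero_pow two_ne_zero, add_zero, mul_one,
      le_div_iff₀ (by positivity)] at hk0
    rw [sub_nonneg, le_div_iff₀ (by positivity)]
    linarith
  rw [fC_eq_one_div, fCInv, mul_div_cancel_left₀ _ hl.ne', Real.sq_sqrt hsqrt, add_sub_cancel,
    mul_one_div, div_mul_cancel_left₀ (by positivity), one_div, inv_inv]

theorem fCInv_fC (hl : 0 < lam) {x : ℝ} (hx : 0 ≤ x) : fCInv lam (fC lam x) = x := by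
  have hle : fC lam x ≤ fC lam 0 := (fC_strictAntiOn hl).antitoneOn self_mem_Ici hx hx
  exact (fC_strictAntiOn hl).injOn (fCInv_nonneg hl.le _) hx (fC_fCInv hl (fC_pos hl x) hle)

theorem continuous_fCInv_fG (hl : 0 < lam) (hs : 0 < sig) :
    Continuous fun x => fCInv lam (fG sig x) := by
  unfold fCInv
  refine continuous_const.mul (Real.continuous_sqrt.comp (.sub (continuous_const.div
    (continuous_const.mul (continuous_fG hs)) fun x => ?_) continuous_const))
  have := fG_pos hs x
  positivity

theorem exists_tangentPair (hl : 0 < lam) (hs : 0 < sig) {x : ℝ} (hx : 0 < x)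
    (h : FG sig x < FC lam x) : ∃ x₁ x₂, IsTangentPair lam sig x₁ x₂ := by
  obtain ⟨y, z, hy, hyz, hfy, hFy, hfz, hFz⟩ := exists_fC_eq_fG_of_FG_lt_FC hl hs hx h
  set p : ℝ → ℝ := fun w => fCInv lam (fG sig w) with hp
  -- The tangents to the Cauchy CDF at `p w` and to the Gaussian CDF at `w` are parallel, and `H w`
  -- is the height of the second one above the first one.
  set H : ℝ → ℝ := fun w => FG sig w - FC lam (p w) - fG sig w * (w - p w) with hH
  have hpy : p y = y := by simp only [hp, ← hfy, fCInv_fC hl hy.le]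
  have hpz : p z = z := by simp only [hp, ← hfz, fCInv_fC hl (hy.trans hyz).le]
  have hHcont : Continuous H := by
    have hpcont := continuous_fCInv_fG hl hs
    exact ((continuous_FG hs).sub (continuous_FC.comp hpcont)).sub
      ((continuous_fG hs).mul (continuous_id.sub hpcont))
  obtain ⟨w, ⟨hyw, hwz⟩, hHw⟩ : 0 ∈ H '' Ioo y z :=
    intermediate_value_Ioo hyz.le hHcont.continuousOn
      ⟨by simp only [hH, hpy]; linarith, by simp only [hH, hpz]; linarith⟩
  have hfw : fG sig w < fC lam y := by
    rw [hfy]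
    exact fG_strictAntiOn hs hy.le (hy.trans hyw).le hyw
  have hfC0 : fC lam y ≤ fC lam 0 := (fC_strictAntiOn hl).antitoneOn self_mem_Ici hy.le hy.le
  have hpw : fC lam (p w) = fG sig w := fC_fCInv hl (fG_pos hs w) (hfw.le.trans hfC0)
  have hpw0 : 0 ≤ p w := fCInv_nonneg hl.le _
  have hpos : 0 < p w := by
    rw [← (fC_strictAntiOn hl).lt_iff_gt hpw0 self_mem_Ici, hpw]
    exact hfw.trans_le hfC0
  have hlt : p w < w := by
    rw [← (fC_strictAntiOn hl).lt_iff_gt (hy.trans hyw).le hpw0, hpw]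
    exact fC_lt_fG_of_mem_Ioo hl hs hy.le ⟨hyw, hwz⟩ hfy.le hfz.le
  refine ⟨p w, w, hpos, hlt, hpw, ?_⟩
  rw [eq_div_iff (sub_pos.2 hlt).ne']
  linarith

end Crossing

section Overbound

variable {lam sig x₁ x₂ : ℝ}

theorem IsTangentPair.pos_right (h : IsTangentPair lam sig x₁ x₂) : 0 < x₂ := h.1.trans h.2.1

theorem IsTangentPair.TR_right (h : IsTangentPair lam sig x₁ x₂) : TR lam x₁ x₂ = FG sig x₂ := by
  obtain ⟨-, hlt, hslope, hchord⟩ := h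
  rw [eq_div_iff (sub_pos.2 hlt).ne', ← hslope] at hchord
  rw [TR]
  linarith

theorem TR_left : TR lam x₁ x₁ = FC lam x₁ := by
  rw [TR, sub_self, mul_zero, zero_add]

theorem FC_lt_TR (hl : 0 < lam) (hx₁ : 0 ≤ x₁) {x : ℝ} (hx : 0 ≤ x) (hne : x ≠ x₁) :
    FC lam x < TR lam x₁ x :=
  FC_lt_tangent hl hx₁ hx hne

theorem IsTangentPair.FG_lt_TR (hs : 0 < sig) (h : IsTangentPair lam sig x₁ x₂) {x : ℝ}
    (hx : 0 ≤ x) (hne : x ≠ x₂) : FG sig x < TR lam x₁ x := by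
  have htangent := FG_lt_tangent hs h.pos_right.le hx hne
  rw [← h.2.2.1, ← h.TR_right, TR] at htangent
  rw [TR]
  linarith

theorem IsTangentPair.FG_lt_FC (hs : 0 < sig) (h : IsTangentPair lam sig x₁ x₂) :
    FG sig x₁ < FC lam x₁ :=
  (h.FG_lt_TR hs h.1.le h.2.1.ne).trans_eq TR_left

theorem IsTangentPair.FC_lt_FG (hl : 0 < lam) (h : IsTangentPair lam sig x₁ x₂) :
    FC lam x₂ < FG sig x₂ :=
  (FC_lt_TR hl h.1.le h.pos_right.le h.2.1.ne').trans_eq h.TR_right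

theorem IsTangentPair.FG_le_FC_of_le (hl : 0 < lam) (hs : 0 < sig)
    (h : IsTangentPair lam sig x₁ x₂) {x : ℝ} (hx0 : 0 < x) (hx : x ≤ x₁) :
    FG sig x ≤ FC lam x := by
  rcases hx.eq_or_lt with rfl | hlt
  · exact (h.FG_lt_FC hs).le
  · by_contra! hFC
    exact (FC_lt_FG_of_le hl hs hx0 hlt hFC.le).not_gt (h.FG_lt_FC hs)

theorem IsTangentPair.FC_le_FG_of_ge (hl : 0 < lam) (hs : 0 < sig)
    (h : IsTangentPair lam sig x₁ x₂) {x : ℝ} (hx : x₂ ≤ x) : FC lam x ≤ FG sig x := by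
  rcases hx.eq_or_lt with rfl | hlt
  · exact (h.FC_lt_FG hl).le
  · exact (FC_lt_FG_of_le hl hs h.pos_right hlt (h.FC_lt_FG hl).le).le

theorem overbounds_of_forall_pos {F G : ℝ → ℝ} (hF : ∀ x, F (-x) = 1 - F x)
    (hG : ∀ x, G (-x) = 1 - G x) (hhalf : ∀ x > 0, 1 / 2 < G x) (hle : ∀ x > 0, F x ≤ G x) :
    Overbounds F G := by
  have hF0 := hF 0
  have hG0 := hG 0
  rw [neg_zero] at hF0 hG0
  constructor <;> intro x hx <;> rcases lt_trichotomy x 0 with hneg | rfl | hpos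
  · linarith [hle _ (neg_pos.2 hneg), hF x, hG x]
  · linarith
  · linarith [hhalf x hpos]
  · linarith [hhalf _ (neg_pos.2 hneg), hG x]
  · linarith
  · exact hle x hpos

theorem exists_tangentPair_iff (hl : 0 < lam) (hs : 0 < sig) :
    (∃ x₁ x₂, IsTangentPair lam sig x₁ x₂) ↔ ¬ Overbounds (FC lam) (FG sig) := by
  constructor
  · rintro ⟨x₁, x₂, h⟩ hover
    exact (hover.2 x₁ (half_lt_FG hs h.1)).not_gt (h.FG_lt_FC hs)
  · contrapose!
    intro hnone
    refine overbounds_of_forall_pos FC_neg (FG_neg hs) (fun _ => half_lt_FG hs) fun x hx => ?_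
    by_contra! hlt
    obtain ⟨x₁, x₂, h⟩ := exists_tangentPair hl hs hx hlt
    exact hnone x₁ x₂ h

theorem TL_neg (x : ℝ) : TL lam x₁ (-x) = 1 - TR lam x₁ x := by
  rw [TL, TR, FC_neg]
  ring

theorem Fob_neg_of_pos (hs : 0 < sig) {x : ℝ} (hx : 0 < x) :
    Fob lam sig x₁ x₂ (-x) = 1 - Fob lam sig x₁ x₂ x := by
  have hsegment : (-x₂ ≤ -x ∧ -x ≤ -x₁) ↔ (x₁ ≤ x ∧ x ≤ x₂) := by
    rw [neg_le_neg_iff, neg_le_neg_iff, and_comm]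
  simp only [Fob, if_pos (neg_nonpos.2 hx.le), if_neg hx.not_ge, hsegment, TL_neg, FC_neg,
    FG_neg hs, min_sub_sub_left]
  split_ifs <;> rfl

theorem Fob_zero (hx₁ : 0 < x₁) (hs : 0 < sig) : Fob lam sig x₁ x₂ 0 = 1 / 2 := by
  have hsegment : ¬ (-x₂ ≤ 0 ∧ 0 ≤ -x₁) := fun h => (neg_nonneg.1 h.2).not_gt hx₁
  rw [Fob, if_pos le_rfl, if_neg hsegment, FC_zero, FG_zero hs, min_self]

theorem IsTangentPair.Fob_eq_FC (hl : 0 < lam) (hs : 0 < sig)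
    (h : IsTangentPair lam sig x₁ x₂) {x : ℝ} (hx : |x| ≤ x₁) :
    Fob lam sig x₁ x₂ x = FC lam x := by
  have hright {x : ℝ} (hx0 : 0 < x) (hx : x ≤ x₁) : Fob lam sig x₁ x₂ x = FC lam x := by
    have hmax : max (FC lam x) (FG sig x) = FC lam x :=
      max_eq_left (h.FG_le_FC_of_le hl hs hx0 hx)
    rw [Fob, if_neg hx0.not_ge]
    split_ifs with hsegment
    · obtain rfl : x = x₁ := le_antisymm hx hsegment.1
      rw [TR_left, hmax, max_self]
    · exact hmax
  obtain ⟨hleft, hle⟩ := abs_le.1 hx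
  rcases lt_trichotomy x 0 with hneg | rfl | hpos
  · rw [← neg_neg x, Fob_neg_of_pos hs (neg_pos.2 hneg), FC_neg,
      hright (neg_pos.2 hneg) (neg_le.1 hleft)]
  · rw [Fob_zero h.1 hs, FC_zero]
  · exact hright hpos hle

theorem IsTangentPair.Fob_eq_TR (hl : 0 < lam) (hs : 0 < sig)
    (h : IsTangentPair lam sig x₁ x₂) {x : ℝ} (hx₁ : x₁ ≤ x) (hx₂ : x ≤ x₂) :
    Fob lam sig x₁ x₂ x = TR lam x₁ x := by
  have hpos : 0 < x := h.1.trans_le hx₁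
  have hFC : FC lam x ≤ TR lam x₁ x := by
    rcases eq_or_ne x x₁ with rfl | hne
    · exact TR_left.ge
    · exact (FC_lt_TR hl h.1.le hpos.le hne).le
  have hFG : FG sig x ≤ TR lam x₁ x := by
    rcases eq_or_ne x x₂ with rfl | hne
    · exact h.TR_right.ge
    · exact (h.FG_lt_TR hs hpos.le hne).le
  rw [Fob, if_neg hpos.not_ge, if_pos ⟨hx₁, hx₂⟩, max_eq_left hFG, max_eq_right hFC]

theorem IsTangentPair.Fob_eq_TL (hl : 0 < lam) (hs : 0 < sig)
    (h : IsTangentPair lam sig x₁ x₂) {x : ℝ} (hx₂ : -x₂ ≤ x) (hx₁ : x ≤ -x₁) :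
    Fob lam sig x₁ x₂ x = TL lam x₁ x := by
  have hx₁' : x₁ ≤ -x := le_neg.1 hx₁
  rw [← neg_neg x, Fob_neg_of_pos hs (h.1.trans_le hx₁'), TL_neg,
    h.Fob_eq_TR hl hs hx₁' (neg_le.1 hx₂)]

theorem IsTangentPair.Fob_eq_FG (hl : 0 < lam) (hs : 0 < sig)
    (h : IsTangentPair lam sig x₁ x₂) {x : ℝ} (hx : x₂ ≤ |x|) :
    Fob lam sig x₁ x₂ x = FG sig x := by
  have hright {x : ℝ} (hx : x₂ ≤ x) : Fob lam sig x₁ x₂ x = FG sig x := by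
    have hmax : max (FC lam x) (FG sig x) = FG sig x :=
      max_eq_right (h.FC_le_FG_of_ge hl hs hx)
    rw [Fob, if_neg (h.pos_right.trans_le hx).not_ge]
    split_ifs with hsegment
    · obtain rfl : x = x₂ := le_antisymm hsegment.2 hx
      rw [h.TR_right, max_self, hmax]
    · exact hmax
  rcases le_abs.1 hx with hx | hx
  · exact hright hx
  · rw [← neg_neg x, Fob_neg_of_pos hs (h.pos_right.trans_le hx), FG_neg hs, hright hx]

/-- The density of the Cauchy-Gaussian overbound: the Cauchy density above the slope
`k = fC lam x₁` of the tangential segments, the Gaussian density below `k`, and `k` between them.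
This closed form shows continuity and monotonicity at once. -/
noncomputable def fob (lam sig x₁ x : ℝ) : ℝ :=
  max (fC lam x) (fC lam x₁) + min (fG sig x) (fC lam x₁) - fC lam x₁

theorem continuous_fob (hl : 0 < lam) (hs : 0 < sig) : Continuous (fob lam sig x₁) :=
  (((continuous_fC hl).max continuous_const).add
    ((continuous_fG hs).min continuous_const)).sub continuous_const

theorem fob_nonneg (hl : 0 < lam) (hs : 0 < sig) (x : ℝ) : 0 ≤ fob lam sig x₁ x := by
  have hmin : 0 ≤ min (fG sig x) (fC lam x₁) := le_min (fG_pos hs x).le (fC_pos hl x₁).le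
  rw [fob]
  linarith [le_max_right (fC lam x) (fC lam x₁)]

theorem fob_neg (x : ℝ) : fob lam sig x₁ (-x) = fob lam sig x₁ x := by
  rw [fob, fob, fC_neg, fG_neg]

theorem fob_antitoneOn (hl : 0 < lam) (hs : 0 < sig) : AntitoneOn (fob lam sig x₁) (Ici 0) := by
  intro x hx y hy hxy
  have hfC := (fC_strictAntiOn hl).antitoneOn hx hy hxy
  have hfG := (fG_strictAntiOn hs).antitoneOn hx hy hxy
  unfold fob
  gcongr

theorem IsTangentPair.fob_eq_fC (hl : 0 < lam) (hs : 0 < sig) (h : IsTangentPair lam sig x₁ x₂)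
    {x : ℝ} (hx : |x| ≤ x₁) : fob lam sig x₁ x = fC lam x := by
  have hfC : fC lam x₁ ≤ fC lam x := (fC_le_fC_iff hl).2 (hx.trans (le_abs_self _))
  have hfG : fC lam x₁ ≤ fG sig x :=
    h.2.2.1 ▸ (fG_le_fG_iff hs).2 ((hx.trans h.2.1.le).trans (le_abs_self _))
  rw [fob, max_eq_left hfC, min_eq_right hfG, add_sub_cancel_right]

theorem IsTangentPair.fob_eq_slope (hl : 0 < lam) (hs : 0 < sig)
    (h : IsTangentPair lam sig x₁ x₂) {x : ℝ} (hx₁ : x₁ ≤ |x|) (hx₂ : |x| ≤ x₂) :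
    fob lam sig x₁ x = fC lam x₁ := by
  have hfC : fC lam x ≤ fC lam x₁ := (fC_le_fC_iff hl).2 (by rwa [abs_of_pos h.1])
  have hfG : fC lam x₁ ≤ fG sig x :=
    h.2.2.1 ▸ (fG_le_fG_iff hs).2 (hx₂.trans (le_abs_self _))
  rw [fob, max_eq_right hfC, min_eq_right hfG, add_sub_cancel_right]

theorem IsTangentPair.fob_eq_fG (hl : 0 < lam) (hs : 0 < sig) (h : IsTangentPair lam sig x₁ x₂)
    {x : ℝ} (hx : x₂ ≤ |x|) : fob lam sig x₁ x = fG sig x := by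
  have hfC : fC lam x ≤ fC lam x₁ :=
    (fC_le_fC_iff hl).2 (by rw [abs_of_pos h.1]; exact h.2.1.le.trans hx)
  have hfG : fG sig x ≤ fC lam x₁ :=
    h.2.2.1 ▸ (fG_le_fG_iff hs).2 (by rwa [abs_of_pos h.pos_right])
  rw [fob, max_eq_right hfC, min_eq_left hfG, add_sub_cancel_left]

theorem hasDerivWithinAt_of_eqOn {𝕜 V : Type*} [NontriviallyNormedField 𝕜]
    [NormedAddCommGroup V] [NormedSpace 𝕜 V] {F G f : 𝕜 → V} {s : Set 𝕜} (hs : IsClosed s)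
    (hFG : EqOn F G s) (hG : ∀ x ∈ s, HasDerivAt G (f x) x) (x : 𝕜) :
    HasDerivWithinAt F (f x) s x := by
  by_cases hx : x ∈ s
  · exact (hG x hx).hasDerivWithinAt.congr hFG (hFG hx)
  · exact HasFDerivWithinAt.of_notMem_closure (by rwa [hs.closure_eq])

theorem hasDerivAt_TR (x : ℝ) : HasDerivAt (TR lam x₁) (fC lam x₁) x :=
  ((((hasDerivAt_id x).sub_const x₁).const_mul _).add_const _).congr_deriv (mul_one _)

theorem convexOn_TR {s : Set ℝ} (hs : Convex ℝ s) : ConvexOn ℝ s (TR lam x₁) := by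
  have haffine : TR lam x₁ = fun x => fC lam x₁ * x + (FC lam x₁ - fC lam x₁ * x₁) := by
    ext x
    rw [TR]
    ring
  rw [haffine]
  exact ((LinearMap.lsmul ℝ ℝ (fC lam x₁)).convexOn hs).add_const _

theorem hasDerivAt_TL (x : ℝ) : HasDerivAt (TL lam x₁) (fC lam x₁) x :=
  ((((hasDerivAt_id x).add_const x₁).const_mul _).add_const _).congr_deriv (mul_one _)

theorem IsTangentPair.hasDerivAt_Fob (hl : 0 < lam) (hs : 0 < sig)
    (h : IsTangentPair lam sig x₁ x₂) (x : ℝ) :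
    HasDerivAt (Fob lam sig x₁ x₂) (fob lam sig x₁ x) x := by
  have hcore := hasDerivWithinAt_of_eqOn (f := fob lam sig x₁) (s := {x | |x| ≤ x₁})
    (isClosed_le continuous_abs continuous_const) (fun y hy => h.Fob_eq_FC hl hs hy)
    (fun y hy => h.fob_eq_fC hl hs hy ▸ hasDerivAt_FC y) x
  have hright := hasDerivWithinAt_of_eqOn (f := fob lam sig x₁) (s := Icc x₁ x₂) isClosed_Icc
    (fun y hy => h.Fob_eq_TR hl hs hy.1 hy.2)
    (fun y hy => h.fob_eq_slope hl hs (hy.1.trans (le_abs_self y))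
      ((abs_of_pos (h.1.trans_le hy.1)).trans_le hy.2) ▸ hasDerivAt_TR y) x
  have hleft := hasDerivWithinAt_of_eqOn (f := fob lam sig x₁) (s := Icc (-x₂) (-x₁)) isClosed_Icc
    (fun y hy => h.Fob_eq_TL hl hs hy.1 hy.2)
    (fun y hy => h.fob_eq_slope hl hs ((le_neg.1 hy.2).trans (neg_le_abs y))
      (abs_le.2 ⟨hy.1, by linarith [hy.2, h.1, h.2.1]⟩) ▸ hasDerivAt_TL y) x
  have htails := hasDerivWithinAt_of_eqOn (f := fob lam sig x₁) (s := {x | x₂ ≤ |x|})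
    (isClosed_le continuous_const continuous_abs) (fun y hy => h.Fob_eq_FG hl hs hy)
    (fun y hy => h.fob_eq_fG hl hs hy ▸ hasDerivAt_FG hs y) x
  have hcover : {x | |x| ≤ x₁} ∪ Icc x₁ x₂ ∪ Icc (-x₂) (-x₁) ∪ {x | x₂ ≤ |x|} = univ := by
    refine eq_univ_of_forall fun y => ?_
    rcases le_total |y| x₁ with h₁ | h₁
    · exact .inl (.inl (.inl h₁))
    rcases le_total x₂ |y| with h₂ | h₂
    · exact .inr h₂
    obtain ⟨hle, hge⟩ := abs_le.1 h₂
    rcases le_abs.1 h₁ with hy | hy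
    · exact .inl (.inl (.inr ⟨hy, hge⟩))
    · exact .inl (.inr ⟨hle, le_neg.1 hy⟩)
  rw [← hasDerivWithinAt_univ, ← hcover]
  exact ((hcore.union hright).union hleft).union htails

theorem IsTangentPair.isSymmUnimodalCDF_Fob (hl : 0 < lam) (hs : 0 < sig)
    (h : IsTangentPair lam sig x₁ x₂) : IsSymmUnimodalCDF (Fob lam sig x₁ x₂) := by
  have hbot : Tendsto (Fob lam sig x₁ x₂) atBot (𝓝 0) := by
    refine (tendsto_FG_atBot (sig := sig)).congr' ?_
    filter_upwards [eventually_le_atBot (-x₂)] with x hx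
    exact (h.Fob_eq_FG hl hs ((le_neg.1 hx).trans (neg_le_abs x))).symm
  have htop : Tendsto (Fob lam sig x₁ x₂) atTop (𝓝 1) := by
    refine (tendsto_FG_atTop (sig := sig)).congr' ?_
    filter_upwards [eventually_ge_atTop x₂] with x hx
    exact (h.Fob_eq_FG hl hs (hx.trans (le_abs_self x))).symm
  obtain ⟨hprob, hcdf⟩ := isProbabilityMeasure_withDensity_and_cdf_eq (continuous_fob hl hs)
    (fob_nonneg hl hs) (h.hasDerivAt_Fob hl hs) hbot htop
  exact ⟨_, hprob, ⟨fob lam sig x₁, (continuous_fob hl hs).measurable, fob_nonneg hl hs, fob_neg,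
    (fob_antitoneOn hl hs).mono Ioi_subset_Ici_self, rfl⟩, hcdf⟩

end Overbound

section Projection

theorem IsSymmUnimodalCDF.isSymmUnimodal {F : ℝ → ℝ} (hF : IsSymmUnimodalCDF F)
    {ν : Measure ℝ} [IsProbabilityMeasure ν] (hν : ∀ x, cdf ν x = F x) : IsSymmUnimodal ν := by
  obtain ⟨ρ, _, hρ, hρF⟩ := hF
  have heq : ν = ρ := Measure.eq_of_cdf ν ρ (StieltjesFunction.ext fun x => by rw [hν, hρF])
  rwa [heq]

variable {μ : Measure ℝ} [IsProbabilityMeasure μ] {lam sig x₁ x₂ : ℝ}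

theorem IsTangentPair.Fob_le_cdf (hl : 0 < lam) (hs : 0 < sig)
    (h : IsTangentPair lam sig x₁ x₂) (hμ : IsSymmUnimodal μ)
    (hC : ∀ x > 0, FC lam x ≤ cdf μ x) (hG : ∀ x > 0, FG sig x ≤ cdf μ x) {x : ℝ} (hx : 0 ≤ x) :
    Fob lam sig x₁ x₂ x ≤ cdf μ x := by
  rcases hx.eq_or_lt with rfl | hpos
  · have := hμ.centeredDecreasing.isNegInvariant
    rw [Fob_zero h.1 hs]
    linarith [two_mul_cdf_of_nonneg (μ := μ) le_rfl, measureReal_nonneg (μ := μ)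
      (s := closedBall 0 0)]
  rcases le_total x x₁ with hx₁ | hx₁
  · rw [h.Fob_eq_FC hl hs (by rwa [abs_of_pos hpos])]
    exact hC x hpos
  rcases le_total x x₂ with hx₂ | hx₂
  · rw [h.Fob_eq_TR hl hs hx₁ hx₂]
    refine sub_nonneg.1 ?_
    calc 0 ≤ min (cdf μ x₁ - TR lam x₁ x₁) (cdf μ x₂ - TR lam x₁ x₂) := by
          rw [TR_left, h.TR_right]
          exact le_min (sub_nonneg.2 (hC x₁ h.1)) (sub_nonneg.2 (hG x₂ h.pos_right))
      _ ≤ cdf μ x - TR lam x₁ x :=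
          (hμ.concaveOn_cdf.sub (convexOn_TR (convex_Ioi 0))).min_le_of_mem_Icc h.1 h.pos_right
            ⟨hx₁, hx₂⟩
  · rw [h.Fob_eq_FG hl hs (by rwa [abs_of_pos hpos])]
    exact hG x hpos

theorem IsTangentPair.peakedLE (hl : 0 < lam) (hs : 0 < sig) (h : IsTangentPair lam sig x₁ x₂)
    (hμ : IsSymmUnimodal μ) (hC : ∀ x > 0, FC lam x ≤ cdf μ x) (hG : ∀ x > 0, FG sig x ≤ cdf μ x)
    {ν : Measure ℝ} [IsProbabilityMeasure ν] (hν : IsSymmUnimodal ν)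
    (hνF : ∀ x, cdf ν x = Fob lam sig x₁ x₂ x) : PeakedLE ν μ := by
  have hnegμ := hμ.centeredDecreasing.isNegInvariant
  have hnegν := hν.centeredDecreasing.isNegInvariant
  exact peakedLE_of_cdf_le fun x hx => (hνF x).trans_le (h.Fob_le_cdf hl hs hμ hC hG hx)

theorem overbounds_projected {Ω : Type*} [MeasurableSpace Ω] {P : Measure Ω}
    [IsProbabilityMeasure P] {N : ℕ} {ε : Fin N → Ω → ℝ} (hε : ∀ i, AEMeasurable (ε i) P)
    (hind : iIndepFun ε P) (S : Fin N → ℝ) (ν : Fin N → Measure ℝ)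
    [∀ i, IsProbabilityMeasure (ν i)] (hPε : ∀ i, CenteredDecreasing (P.map (ε i)))
    (hν : ∀ i, CenteredDecreasing (ν i)) (hpeaked : ∀ i, PeakedLE (ν i) (P.map (ε i))) :
    Overbounds (cdf (projected S ν)) (cdf (P.map fun ω => ∑ i, S i * ε i ω)) := by
  have hprob (i : Fin N) : IsProbabilityMeasure (P.map (ε i)) :=
    Measure.isProbabilityMeasure_map (hε i)
  have hprobε (i : Fin N) : IsProbabilityMeasure ((P.map (ε i)).map fun x => S i • x) :=
    Measure.isProbabilityMeasure_map (by fun_prop)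
  have hprobν (i : Fin N) : IsProbabilityMeasure ((ν i).map fun x => |S i| • x) :=
    Measure.isProbabilityMeasure_map (by fun_prop)
  have hsum : P.map (fun ω => ∑ i, S i * ε i ω) =
      convN N fun i => (P.map (ε i)).map fun x => S i • x := by
    calc P.map (fun ω => ∑ i, S i * ε i ω) = P.map (∑ i, fun ω => S i * ε i ω) := by
          rw [← Finset.sum_fn]
      _ = convN N fun i => P.map fun ω => S i * ε i ω :=
          map_sum_eq_convN P N _ (fun i => (hε i).const_mul _)
            (hind.comp (fun i x => S i * x) fun i => by fun_prop)
      _ = convN N fun i => (P.map (ε i)).map fun x => S i • x := by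
          congr with i : 1
          exact (AEMeasurable.map_map_of_aemeasurable (by fun_prop) (hε i)).symm
  have hcε := centeredDecreasing_convN N _ fun i => (hPε i).map_smul (S i)
  have hcν := centeredDecreasing_convN N _ fun i => (hν i).map_smul |S i|
  have hnegε := hcε.isNegInvariant
  have hnegν := hcν.isNegInvariant
  rw [hsum]
  exact (peakedLE_convN N _ _ (fun i => (hν i).map_smul |S i|) (fun i => (hPε i).map_smul (S i))
    fun i => (hpeaked i).map_smul (norm_abs_eq_norm (S i))).overbounds

end Projection

theorem mainTheorem1_general {Ω : Type*} [MeasurableSpace Ω] (P : Measure Ω)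
    [IsProbabilityMeasure P] {N : ℕ} (ε : Fin N → Ω → ℝ) (hε : ∀ i, AEMeasurable (ε i) P)
    (hind : iIndepFun ε P) (hsu : ∀ i, IsSymmUnimodal (P.map (ε i))) (S sig lam : Fin N → ℝ)
    (hs : ∀ i, 0 < sig i) (hl : ∀ i, 0 < lam i)
    (hG : ∀ i, ∀ x > 0, FG (sig i) x ≤ cdf (P.map (ε i)) x)
    (hC : ∀ i, ∀ x > 0, FC (lam i) x ≤ cdf (P.map (ε i)) x) :
    (∀ i, (∃ x₁ x₂, IsTangentPair (lam i) (sig i) x₁ x₂) ↔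
      ¬ Overbounds (FC (lam i)) (FG (sig i))) ∧
    ∀ x₁ x₂ : Fin N → ℝ, (∀ i, IsTangentPair (lam i) (sig i) (x₁ i) (x₂ i)) →
      (∀ i,
        ((∀ x, |x| ≤ x₁ i → Fob (lam i) (sig i) (x₁ i) (x₂ i) x = FC (lam i) x) ∧
          (∀ x, x₁ i ≤ x → x ≤ x₂ i →
            Fob (lam i) (sig i) (x₁ i) (x₂ i) x = TR (lam i) (x₁ i) x) ∧
          (∀ x, -x₂ i ≤ x → x ≤ -x₁ i →
            Fob (lam i) (sig i) (x₁ i) (x₂ i) x = TL (lam i) (x₁ i) x) ∧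
          (∀ x, x₂ i ≤ |x| → Fob (lam i) (sig i) (x₁ i) (x₂ i) x = FG (sig i) x)) ∧
        IsSymmUnimodalCDF (Fob (lam i) (sig i) (x₁ i) (x₂ i)) ∧
        Overbounds (Fob (lam i) (sig i) (x₁ i) (x₂ i)) (cdf (P.map (ε i)))) ∧
      ∀ ν : Fin N → Measure ℝ,
        (∀ i, IsProbabilityMeasure (ν i) ∧
          ∀ x, cdf (ν i) x = Fob (lam i) (sig i) (x₁ i) (x₂ i) x) →
        Overbounds (cdf (projected S ν)) (cdf (P.map (fun ω => ∑ i, S i * ε i ω))) := by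
  have hprob (i : Fin N) : IsProbabilityMeasure (P.map (ε i)) :=
    Measure.isProbabilityMeasure_map (hε i)
  refine ⟨fun i => exists_tangentPair_iff (hl i) (hs i), fun x₁ x₂ ht => ?_⟩
  have hFob (i : Fin N) := (ht i).isSymmUnimodalCDF_Fob (hl i) (hs i)
  have hpeaked (i : Fin N) {ρ : Measure ℝ} [IsProbabilityMeasure ρ] (hρ : IsSymmUnimodal ρ) :=
    (ht i).peakedLE (hl i) (hs i) (hsu i) (hC i) (hG i) hρ
  refine ⟨fun i => ⟨⟨fun x => (ht i).Fob_eq_FC (hl i) (hs i),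
    fun x => (ht i).Fob_eq_TR (hl i) (hs i), fun x => (ht i).Fob_eq_TL (hl i) (hs i),
    fun x => (ht i).Fob_eq_FG (hl i) (hs i)⟩, hFob i, ?_⟩, fun ν hν => ?_⟩
  · obtain ⟨ρ, _, hρ, hρF⟩ := hFob i
    have hnegε := (hsu i).centeredDecreasing.isNegInvariant
    have hnegρ := hρ.centeredDecreasing.isNegInvariant
    exact funext hρF ▸ (hpeaked i hρ hρF).overbounds
  · have hprobν (i : Fin N) : IsProbabilityMeasure (ν i) := (hν i).1
    have hsuν (i : Fin N) : IsSymmUnimodal (ν i) := (hFob i).isSymmUnimodal (hν i).2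
    exact overbounds_projected hε hind S ν (fun i => (hsu i).centeredDecreasing)
      (fun i => (hsuν i).centeredDecreasing) fun i => hpeaked i (hsuν i) (hν i).2

end CauchyGaussian

open MeasureTheory ProbabilityTheory CauchyGaussian in
theorem mainTheorem1 {Ω : Type*} [MeasurableSpace Ω] (P : Measure Ω) [IsProbabilityMeasure P]
    {N : ℕ} (ε : Fin N → Ω → ℝ) (hmeas : ∀ i, Measurable (ε i)) (hind : iIndepFun ε P)
    (hsu : ∀ i, IsSymmUnimodal (P.map (ε i)))
    (S sig lam : Fin N → ℝ)
    (hsig : ∀ i, IsOptimalGaussianScale (cdf (P.map (ε i))) (sig i))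
    (hlam : ∀ i, IsOptimalCauchyScale (cdf (P.map (ε i))) (sig i) (lam i)) :
    -- the tangential link exists unless the Cauchy model already overbounds the Gaussian one
    (∀ i, (∃ x₁ x₂, IsTangentPair (lam i) (sig i) x₁ x₂) ↔
      ¬ Overbounds (FC (lam i)) (FG (sig i))) ∧
    ∀ x₁ x₂ : Fin N → ℝ, (∀ i, IsTangentPair (lam i) (sig i) (x₁ i) (x₂ i)) →
      (∀ i,
        -- Cauchy core, tangential segments, Gaussian tails
        ((∀ x, |x| ≤ x₁ i → Fob (lam i) (sig i) (x₁ i) (x₂ i) x = FC (lam i) x) ∧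
          (∀ x, x₁ i ≤ x → x ≤ x₂ i →
            Fob (lam i) (sig i) (x₁ i) (x₂ i) x = TR (lam i) (x₁ i) x) ∧
          (∀ x, -x₂ i ≤ x → x ≤ -x₁ i →
            Fob (lam i) (sig i) (x₁ i) (x₂ i) x = TL (lam i) (x₁ i) x) ∧
          (∀ x, x₂ i ≤ |x| → Fob (lam i) (sig i) (x₁ i) (x₂ i) x = FG (sig i) x)) ∧
        IsSymmUnimodalCDF (Fob (lam i) (sig i) (x₁ i) (x₂ i)) ∧
        Overbounds (Fob (lam i) (sig i) (x₁ i) (x₂ i)) (cdf (P.map (ε i)))) ∧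
      -- the overbound is preserved by projection to the position domain
      ∀ ν : Fin N → Measure ℝ,
        (∀ i, IsProbabilityMeasure (ν i) ∧
          ∀ x, cdf (ν i) x = Fob (lam i) (sig i) (x₁ i) (x₂ i) x) →
        Overbounds (cdf (projected S ν)) (cdf (P.map (fun ω => ∑ i, S i * ε i ω))) :=
  mainTheorem1_general P ε (fun i => (hmeas i).aemeasurable) hind hsu S sig lam
    (fun i => (hsig i).1.1) (fun i => (hlam i).1.1) (fun i => (hsig i).1.2.2)
    fun i => (hlam i).1.2.2.1
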